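/- Let $d>1$ and $b\ge 2$ be integers. Hilbert curves. For $m\ge 0$ let $I^m(k)=[k2^{-dm},(k+1)2^{-dm}]$, $0\le k<2^{dm}$, and let $E^m(\kappa)=\prod_{j=1}^d[\kappa_j2^{-m},(\kappa_j+1)2^{-m}]$, $\kappa\in\{0,\dots,2^m-1\}^d$. Let $H_m$ $(m\ge0)$ map the intervals $I^m(k)$ to the cubes $E^m(\kappa)$ so that, for every $m$: (i) $H_m(I^m(k))\ne H_m(I^m(k'))$ for $k\neq k'$; (ii) $H_m(I^m(k))$ and $H_m(I^m(k+1))$ have a common $(d-1)$-dimensional face; (iii) $\bigcup_{\ell=0}^{2^d-1}H_{m+1}(I^{m+1}(2^dk+\ell))=H_m(I^m(k))$. The Hilbert curve $H:[0,1]\to[0,1]^d$ of such a sequence is $H(x)=\lim_{m\to\infty}H_m(x)$: the point to which the cubes $H_m(I^m(k_m))$ shrink, where $x\in I^m(k_m)$. Van der Corput points. If the integer $i\ge 0$ is $i=\sum_{k\ge1}d_kb^{k-1}$ with digits $d_k\in\{0,\dots,b-1\}$, put $\varphi_b(i)=\sum_{k\ge 1}d_kb^{-k}$. Let $x_1,\dots,x_n$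 be the first $n$ van der Corput points in base $b$, in either of the two usual numberings: $x_i=\varphi_b(i-1)$ for all $i$, or $x_i=\varphi_b(i)$ for all $i$. Star-discrepancy. For $\mathcal P=(P_1,\dots,P_n)$ in $[0,1]^d$, $$D_n^*(\mathcal P)=\sup_{a\in[0,1)^d}\left|\frac{\#\{i: P_i\in\prod_{j=1}^d[0,a_j)\}}{n}-\prod_{j=1}^d a_j\right|.$$ Theorem. There is a constant $C$, depending only on $d$ and $b$, such that for every Hilbert curve $H$ in dimension $d$ and every $n\ge1$ the points $P_i=H(x_i)$, $i=1,\dots,n$, satisfy $$D_n^*(\mathcal P)\le\frac{4d(b-1)\sqrt{d+3}}{1-b^{-(d-1)/d}}\,n^{-1/d}+C\,n^{-2/d}\log n .$$ -/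

import Mathlib

/-- The closed subinterval `[k / 2^(d m), (k + 1) / 2^(d m)]` of `[0, 1]`. -/
def hilbertInterval (d m k : ℕ) : Set ℝ :=
  Set.Icc ((k : ℝ) / 2 ^ (d * m)) (((k : ℝ) + 1) / 2 ^ (d * m))

/-- The closed subcube `∏ j, [κ j / 2^m, (κ j + 1) / 2^m]` of `[0, 1]^d`. -/
def hilbertCube (d m : ℕ) (κ : Fin d → ℕ) : Set (Fin d → ℝ) :=
  {p | ∀ j, (κ j : ℝ) / 2 ^ m ≤ p j ∧ p j ≤ ((κ j : ℝ) + 1) / 2 ^ m}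

/-- Two subcubes of the same level, given by their indices, have one
`(d - 1)`-dimensional face in common: the indices differ by one in exactly one coordinate. -/
def CubesAdjacent {d : ℕ} (κ κ' : Fin d → ℕ) : Prop :=
  ∃ j, (κ' j = κ j + 1 ∨ κ j = κ' j + 1) ∧ ∀ i, i ≠ j → κ i = κ' i

/-- `h m k` is the index of the subcube of level `m` that is assigned to the `k`-th interval
of level `m`, that is, `H_m (I_d^m (k)) = E_d^m (h m k)`, for `k < 2^(d m)`
(values at other `k` play no role). This is the notion of a sequence of mappings `H_m`
that produces a Hilbert curve. -/
structure IsHilbertSequence (d : ℕ) (h : ℕ → ℕ → Fin d → ℕ) : Prop where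
  /-- the indices of the subcubes of level `m` lie in `{0, …, 2^m - 1}^d` -/
  index_lt : ∀ m k, k < 2 ^ (d * m) → ∀ j, h m k j < 2 ^ m
  /-- bijection -/
  bijection : ∀ m k k', k < 2 ^ (d * m) → k' < 2 ^ (d * m) → k ≠ k' →
    hilbertCube d m (h m k) ≠ hilbertCube d m (h m k')
  /-- adjacency -/
  adjacency : ∀ m k, k + 1 < 2 ^ (d * m) → CubesAdjacent (h m k) (h m (k + 1))
  /-- nesting -/
  nesting : ∀ m k, k < 2 ^ (d * m) →
    ⋃ ℓ ∈ Finset.range (2 ^ d), hilbertCube d (m + 1) (h (m + 1) (2 ^ d * k + ℓ)) =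
      hilbertCube d m (h m k)

/-- The number `k < 2^(d m)` of an interval of level `m` that contains `x ∈ [0, 1]`. -/
noncomputable def hilbertIntervalIndex (d m : ℕ) (x : ℝ) : ℕ :=
  min ⌊x * 2 ^ (d * m)⌋₊ (2 ^ (d * m) - 1)

theorem hilbertIntervalIndex_lt (d m : ℕ) (x : ℝ) :
    hilbertIntervalIndex d m x < 2 ^ (d * m) := by
  have h : 0 < 2 ^ (d * m) := by positivity
  unfold hilbertIntervalIndex
  omega

theorem mem_hilbertInterval (d m : ℕ) (x : ℝ) (hx : x ∈ Set.Icc (0 : ℝ) 1) :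
    x ∈ hilbertInterval d m (hilbertIntervalIndex d m x) := by
  obtain ⟨h0, h1⟩ := hx
  have hp : (0 : ℝ) < 2 ^ (d * m) := by positivity
  have hp' : 1 ≤ 2 ^ (d * m) := Nat.one_le_two_pow
  have hfl : (⌊x * 2 ^ (d * m)⌋₊ : ℝ) ≤ x * 2 ^ (d * m) := Nat.floor_le (by positivity)
  have hlt := Nat.lt_floor_add_one (x * 2 ^ (d * m))
  have hle : x * 2 ^ (d * m) ≤ 2 ^ (d * m) := by nlinarith
  unfold hilbertInterval hilbertIntervalIndex
  rw [Set.mem_Icc, div_le_iff₀ hp, le_div_iff₀ hp, Nat.cast_min, Nat.cast_sub hp']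
  push_cast
  refine ⟨(min_le_left _ _).trans hfl, ?_⟩
  rcases min_cases (⌊x * 2 ^ (d * m)⌋₊ : ℝ) ((2 : ℝ) ^ (d * m) - 1) with h | h <;> linarith

/-- The Hilbert curve `H(x) = lim_{m → ∞} H_m(x)`: the subcubes `H_m (I)`, for the intervals
`I ∋ x` of level `m = 0, 1, 2, …`, shrink to the point `H(x)`, so that `H(x)` is the limit of
their lower corners. -/
noncomputable def hilbertCurve (d : ℕ) (h : ℕ → ℕ → Fin d → ℕ) (x : ℝ) : Fin d → ℝ :=
  Filter.limUnder Filter.atTop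
    (fun (m : ℕ) (j : Fin d) => (h m (hilbertIntervalIndex d m x) j : ℝ) / 2 ^ m)

/-- The van der Corput mapping in base `b`: the integer `i = ∑ d_k b^(k-1)` with base-`b` digits
`d_k` is sent to `∑ d_k b^(-k)` (the sum has finitely many nonzero terms when `2 ≤ b`). -/
noncomputable def vanDerCorput (b i : ℕ) : ℝ :=
  ∑' k : ℕ, ((i / b ^ k % b : ℕ) : ℝ) / (b : ℝ) ^ (k + 1)

/-- The anchored box `[0, a)`. -/
def anchoredBox {d : ℕ} (a : Fin d → ℝ) : Set (Fin d → ℝ) :=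
  {p | ∀ j, 0 ≤ p j ∧ p j < a j}

open Classical in
/-- The signed discrepancy of the points `P` at the set `S`. -/
noncomputable def signedDiscrepancy {d n : ℕ} (P : Fin n → Fin d → ℝ)
    (S : Set (Fin d → ℝ)) : ℝ :=
  ((Finset.univ.filter (fun i => P i ∈ S)).card : ℝ) / n - MeasureTheory.volume.real S

/-- The star-discrepancy of the points `P` (a supremum of numbers in `[0, 1]`). -/
noncomputable def starDiscrepancy {d n : ℕ} (P : Fin n → Fin d → ℝ) : ℝ :=
  ⨆ a : {a : Fin d → ℝ // ∀ j, 0 ≤ a j ∧ a j < 1}, |signedDiscrepancy P (anchoredBox a.1)|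

/-!
Let `H` be a Hilbert curve and `B = [0, a)` an anchored box. The proof compares the number of
points `H(x_i)` in `B` with `n vol(B)` on the parameter side, where the set in question is
`A = H⁻¹(B) ⊆ [0, 1)`.

The curve preserves measure (`measurePreserving_hilbertCurve`): at level `m` it assigns intervals
of length `2^(-dm)` to cubes of the same volume, so that the measure of `H⁻¹(F)` for closed `F` is
at most the volume of the `2^(-m)`-neighbourhood of `F` in the cube. Letting `m → ∞`, the image
measure is dominated by the uniform measure on closed sets, hence by inner regularity on all
measurable sets, and two probability measures one of which dominates the other are equal.
In particular `A` has measure `vol(B)`.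

Any `b^j` consecutive van der Corput points, starting anywhere, have exactly one member in each
interval `[c / b^j, (c + 1) / b^j)`, because that interval is determined by the residue of the
index modulo `b^j` (`sum_digitReversal`). The counting error of such a block is therefore at most
the number of intervals that meet both `A` and its complement
(`abs_sum_indicator_sub_le_card_crossingIndices`).

Since an interval of length `t ≤ 2^(-dm)` is covered by two consecutive intervals of level `m`, and
these are mapped to adjacent cubes, `H` is Hölder continuous with exponent `1 / d` and constant `4`
in the supremum norm (`abs_hilbertCurve_sub_le`). A cut interval of length `b^(-j)` is thus mapped
into one of the `d` slabs `|p_i - a_i| ≤ 4 b^(-j/d)`, and as `H` preserves measure there are at most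
`8 d b^(j(d-1)/d)` of them (`card_crossingIndices_le`). Splitting `n` into at most `b - 1` blocks of
each length `b^j ≤ n` and summing the geometric series gives the bound
`8 d (b - 1) / (1 - b^(-(d-1)/d)) n^(-1/d)` for the discrepancy, for both numberings of the points.
It implies the assertion with `C = 0`, because `2 ≤ √(d + 3)`.
-/

open MeasureTheory Filter Topology

/-! ### The Hilbert curve -/

theorem hilbertCube_eq_Icc (d m : ℕ) (κ : Fin d → ℕ) :
    hilbertCube d m κ =
      Set.Icc (fun j => (κ j : ℝ) / 2 ^ m) (fun j => ((κ j : ℝ) + 1) / 2 ^ m) := by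
  ext p
  simp only [hilbertCube, Set.mem_ofPred_eq, Set.mem_Icc, Pi.le_def]
  exact forall_and

theorem lowerCorner_mem_hilbertCube (d m : ℕ) (κ : Fin d → ℕ) :
    (fun j => (κ j : ℝ) / 2 ^ m) ∈ hilbertCube d m κ := by
  intro j
  exact ⟨le_rfl, div_le_div_of_nonneg_right (by linarith) (by positivity)⟩

theorem dist_le_of_mem_hilbertCube {d m : ℕ} {κ : Fin d → ℕ} {p q : Fin d → ℝ}
    (hp : p ∈ hilbertCube d m κ) (hq : q ∈ hilbertCube d m κ) : dist p q ≤ (1 / 2) ^ m := by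
  refine (dist_pi_le_iff (by positivity)).2 fun j => ?_
  obtain ⟨h1, h2⟩ := hp j
  obtain ⟨h3, h4⟩ := hq j
  rw [add_div] at h2 h4
  rw [Real.dist_eq, abs_sub_le_iff, one_div_pow]
  constructor <;> linarith

theorem hilbertIntervalIndex_succ (d m : ℕ) (x : ℝ) :
    hilbertIntervalIndex d (m + 1) x / 2 ^ d = hilbertIntervalIndex d m x := by
  have hfl : ⌊x * 2 ^ (d * m)⌋₊ = ⌊x * 2 ^ (d * (m + 1))⌋₊ / 2 ^ d := by
    rw [← Nat.floor_div_natCast]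
    congr 1
    push_cast
    rw [mul_add, pow_add, mul_one]
    field_simp
  have hpow : (2 : ℕ) ^ (d * (m + 1)) = 2 ^ d * 2 ^ (d * m) := by ring
  have hsub : (2 ^ (d * (m + 1)) - 1) / 2 ^ d = 2 ^ (d * m) - 1 := by
    have h1 : 0 < 2 ^ d := by positivity
    have h2 : 0 < 2 ^ (d * m) := by positivity
    rw [hpow, Nat.mul_sub_div _ _ _ (Nat.mul_pos h1 h2)]
    simp
  unfold hilbertIntervalIndex
  rw [hfl, ← hsub]
  have hmono : Monotone fun k : ℕ => k / 2 ^ d := fun _ _ hk => Nat.div_le_div_right hk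
  exact hmono.map_min

namespace IsHilbertSequence

variable {d : ℕ} {h : ℕ → ℕ → Fin d → ℕ}

theorem hilbertCube_subset (hh : IsHilbertSequence d h) {m k : ℕ} (hk : k < 2 ^ (d * (m + 1))) :
    hilbertCube d (m + 1) (h (m + 1) k) ⊆ hilbertCube d m (h m (k / 2 ^ d)) := by
  have h1 : 0 < 2 ^ d := by positivity
  have hpow : (2 : ℕ) ^ (d * (m + 1)) = 2 ^ d * 2 ^ (d * m) := by ring
  have hk' : k / 2 ^ d < 2 ^ (d * m) := Nat.div_lt_of_lt_mul (hpow ▸ hk)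
  rw [← hh.nesting m _ hk']
  intro p hp
  simp only [Set.mem_iUnion, Finset.mem_range]
  refine ⟨k % 2 ^ d, Nat.mod_lt _ h1, ?_⟩
  rwa [Nat.div_add_mod]

/-- The cubes assigned to the intervals containing `x` decrease with the level. -/
theorem antitone_hilbertCube (hh : IsHilbertSequence d h) (x : ℝ) :
    Antitone fun m => hilbertCube d m (h m (hilbertIntervalIndex d m x)) := by
  refine antitone_nat_of_succ_le fun m => ?_
  have := hh.hilbertCube_subset (hilbertIntervalIndex_lt d (m + 1) x)
  rwa [hilbertIntervalIndex_succ] at this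

theorem tendsto_hilbertCurve (hh : IsHilbertSequence d h) (x : ℝ) :
    Tendsto (fun (m : ℕ) (j : Fin d) => (h m (hilbertIntervalIndex d m x) j : ℝ) / 2 ^ m) atTop
      (𝓝 (hilbertCurve d h x)) := by
  refine tendsto_nhds_limUnder (cauchySeq_tendsto_of_complete ?_)
  refine cauchySeq_of_le_tendsto_0 (fun m => (1 / 2 : ℝ) ^ m) (fun n m N hn hm => ?_)
    (tendsto_pow_atTop_nhds_zero_of_lt_one (by norm_num) (by norm_num))
  exact dist_le_of_mem_hilbertCube
    (hh.antitone_hilbertCube x hn (lowerCorner_mem_hilbertCube d _ _))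
    (hh.antitone_hilbertCube x hm (lowerCorner_mem_hilbertCube d _ _))

theorem hilbertCurve_mem (hh : IsHilbertSequence d h) (m : ℕ) (x : ℝ) :
    hilbertCurve d h x ∈ hilbertCube d m (h m (hilbertIntervalIndex d m x)) := by
  refine IsClosed.mem_of_tendsto ?_ (hh.tendsto_hilbertCurve x) ?_
  · rw [hilbertCube_eq_Icc]
    exact isClosed_Icc
  · filter_upwards [eventually_ge_atTop m] with n hn
    exact hh.antitone_hilbertCube x hn (lowerCorner_mem_hilbertCube d _ _)

theorem hilbertCurve_nonneg (hh : IsHilbertSequence d h) (x : ℝ) (j : Fin d) :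
    0 ≤ hilbertCurve d h x j :=
  le_trans (by positivity) (hh.hilbertCurve_mem 0 x j).1

theorem measurable_hilbertCurve (hh : IsHilbertSequence d h) : Measurable (hilbertCurve d h) := by
  refine measurable_of_tendsto_metrizable (fun m => ?_)
    (tendsto_pi_nhds.2 hh.tendsto_hilbertCurve)
  have hidx : Measurable (hilbertIntervalIndex d m) := by
    unfold hilbertIntervalIndex
    fun_prop
  exact (measurable_from_nat (f := fun k (j : Fin d) => (h m k j : ℝ) / 2 ^ m)).comp hidx

/-! ### The Hilbert curve preserves measure -/

/-- The Hilbert curve transports the uniform measure to a measure that is dominated by the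
uniform measure on closed sets `F`: the cubes of level `m` that meet `F` have the same total
measure as the intervals assigned to them, and they lie within distance `2⁻ᵐ` of `F`. -/
theorem volume_preimage_le (hh : IsHilbertSequence d h) {F : Set (Fin d → ℝ)} (hF : IsClosed F) :
    volume.restrict (Set.Ico (0 : ℝ) 1) (hilbertCurve d h ⁻¹' F) ≤
      volume.restrict (Set.Icc (0 : Fin d → ℝ) 1) F := by
  classical
  set μ := (volume : Measure (Fin d → ℝ)).restrict (Set.Icc 0 1) with hμ
  have hfin : IsFiniteMeasure μ := ⟨by
    rw [hμ, Measure.restrict_apply_univ]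
    exact isCompact_Icc.measure_lt_top⟩
  have hlim : Tendsto (fun m : ℕ => μ (Metric.cthickening ((1 / 2 : ℝ) ^ m) F)) atTop
      (𝓝 (μ F)) :=
    (tendsto_measure_cthickening_of_isClosed (μ := μ) ⟨1, one_pos, measure_ne_top _ _⟩ hF).comp
      (tendsto_pow_atTop_nhds_zero_of_lt_one (by norm_num) (by norm_num))
  refine ge_of_tendsto' hlim fun m => ?_
  set K := (Finset.range (2 ^ (d * m))).filter
    fun k => (hilbertCube d m (h m k) ∩ F).Nonempty with hK
  let Q : ℕ → Set (Fin d → ℝ) := fun k =>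
    Set.univ.pi fun j => Set.Ico ((h m k j : ℝ) / 2 ^ m) (((h m k j : ℝ) + 1) / 2 ^ m)
  let J : ℕ → Set ℝ := fun k =>
    Set.Ico ((k : ℝ) / 2 ^ (d * m)) (((k : ℝ) + 1) / 2 ^ (d * m))
  have hJ : ∀ k, volume (J k) = ENNReal.ofReal ((1 / 2 ^ (d * m) : ℝ)) := fun k => by
    simp only [J, Real.volume_Ico]
    congr 1
    ring
  have hQ : ∀ k, volume (Q k) = ENNReal.ofReal ((1 / 2 ^ (d * m) : ℝ)) := fun k => by
    have hside : ∀ j, ((h m k j : ℝ) + 1) / 2 ^ m - (h m k j : ℝ) / 2 ^ m = 1 / 2 ^ m :=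
      fun j => by ring
    simp only [Q, Real.volume_pi_Ico, hside, Finset.prod_const, Finset.card_univ,
      Fintype.card_fin]
    rw [← ENNReal.ofReal_pow (by positivity), one_div_pow, ← pow_mul, mul_comm]
  have hQc : ∀ k, Q k ⊆ hilbertCube d m (h m k) := fun k p hp j =>
    ⟨(hp j trivial).1, (hp j trivial).2.le⟩
  have hsub1 : hilbertCurve d h ⁻¹' F ∩ Set.Ico 0 1 ⊆ ⋃ k ∈ K, J k := by
    rintro x ⟨hxF, hx0, hx1⟩
    have hp : (0 : ℝ) < 2 ^ (d * m) := by positivity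
    have hlt : ⌊x * 2 ^ (d * m)⌋₊ < 2 ^ (d * m) := by
      rw [Nat.floor_lt (by positivity)]
      push_cast
      nlinarith
    have hidx : hilbertIntervalIndex d m x = ⌊x * 2 ^ (d * m)⌋₊ :=
      min_eq_left (Nat.le_sub_one_of_lt hlt)
    refine Set.mem_biUnion (x := hilbertIntervalIndex d m x) ?_ ?_
    · exact Finset.mem_filter.2 ⟨Finset.mem_range.2 (hilbertIntervalIndex_lt d m x),
        _, hh.hilbertCurve_mem m x, hxF⟩
    · rw [hidx]
      exact ⟨(div_le_iff₀ hp).2 (Nat.floor_le (by positivity)),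
        (lt_div_iff₀ hp).2 (Nat.lt_floor_add_one _)⟩
  have hdisj : (K : Set ℕ).PairwiseDisjoint Q := by
    intro k hk k' hk' hne
    refine Set.disjoint_left.2 fun p hp hp' => ?_
    simp only [hK, Finset.coe_filter, Finset.mem_range, Set.mem_ofPred_eq] at hk hk'
    refine hh.bijection m k k' hk.1 hk'.1 hne (congrArg _ (funext fun j => ?_))
    obtain ⟨h1, h2⟩ := hp j trivial
    obtain ⟨h3, h4⟩ := hp' j trivial
    have hp : (0 : ℝ) < 2 ^ m := by positivity
    have h5 := (div_lt_div_iff_of_pos_right hp).1 (h1.trans_lt h4)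
    have h6 := (div_lt_div_iff_of_pos_right hp).1 (h3.trans_lt h2)
    norm_cast at h5 h6
    omega
  have hsub2 : (⋃ k ∈ K, Q k) ⊆ Metric.cthickening ((1 / 2 : ℝ) ^ m) F ∩ Set.Icc 0 1 := by
    intro p hp
    simp only [Set.mem_iUnion] at hp
    obtain ⟨k, hk, hpk⟩ := hp
    obtain ⟨hk, q, hq, hqF⟩ := Finset.mem_filter.1 hk
    refine ⟨Metric.mem_cthickening_of_dist_le p q _ F hqF
      (dist_le_of_mem_hilbertCube (hQc k hpk) hq), fun j => ?_, fun j => ?_⟩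
    · exact le_trans (by positivity) (hpk j trivial).1
    · refine (hpk j trivial).2.le.trans ((div_le_one (by positivity)).2 ?_)
      exact_mod_cast hh.index_lt m k (Finset.mem_range.1 hk) j
  calc volume.restrict (Set.Ico (0 : ℝ) 1) (hilbertCurve d h ⁻¹' F)
      = volume (hilbertCurve d h ⁻¹' F ∩ Set.Ico 0 1) :=
        Measure.restrict_apply (hh.measurable_hilbertCurve hF.measurableSet)
    _ ≤ volume (⋃ k ∈ K, J k) := measure_mono hsub1
    _ ≤ ∑ k ∈ K, volume (J k) := measure_biUnion_finset_le _ _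
    _ = ∑ k ∈ K, volume (Q k) := by simp only [hJ, hQ]
    _ = volume (⋃ k ∈ K, Q k) := (measure_biUnion_finset hdisj fun k _ =>
        MeasurableSet.univ_pi fun j => measurableSet_Ico).symm
    _ ≤ volume (Metric.cthickening ((1 / 2 : ℝ) ^ m) F ∩ Set.Icc 0 1) := measure_mono hsub2
    _ = μ (Metric.cthickening ((1 / 2 : ℝ) ^ m) F) :=
        (Measure.restrict_apply Metric.isClosed_cthickening.measurableSet).symm

theorem measurePreserving_hilbertCurve (hh : IsHilbertSequence d h) :
    MeasurePreserving (hilbertCurve d h) (volume.restrict (Set.Ico (0 : ℝ) 1))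
      (volume.restrict (Set.Icc (0 : Fin d → ℝ) 1)) := by
  have hmeas := hh.measurable_hilbertCurve
  refine ⟨hmeas, ?_⟩
  have h1 : IsProbabilityMeasure (volume.restrict (Set.Ico (0 : ℝ) 1)) := ⟨by simp⟩
  have h2 : IsProbabilityMeasure (volume.restrict (Set.Icc (0 : Fin d → ℝ) 1)) := ⟨by
    rw [Measure.restrict_apply_univ, Real.volume_Icc_pi]
    simp⟩
  have h3 := Measure.isProbabilityMeasure_map
    (μ := volume.restrict (Set.Ico (0 : ℝ) 1)) hmeas.aemeasurable
  refine Measure.eq_of_le_of_measure_univ_eq (Measure.le_iff.2 fun s hs => ?_) (by simp)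
  rw [hs.measure_eq_iSup_isClosed_of_ne_top (measure_ne_top _ _)]
  refine iSup₂_le fun F hFs => iSup_le fun hF => ?_
  rw [Measure.map_apply hmeas hF.measurableSet]
  exact (hh.volume_preimage_le hF).trans (measure_mono hFs)

theorem volume_real_preimage (hh : IsHilbertSequence d h) {S : Set (Fin d → ℝ)}
    (hS : MeasurableSet S) :
    volume.real (hilbertCurve d h ⁻¹' S ∩ Set.Ico 0 1) = volume.real (S ∩ Set.Icc 0 1) := by
  have h1 := hh.measurePreserving_hilbertCurve.measure_preimage hS.nullMeasurableSet
  rw [Measure.restrict_apply (hh.measurable_hilbertCurve hS), Measure.restrict_apply hS] at h1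
  rw [measureReal_def, measureReal_def, h1]

/-! ### Hölder continuity of the Hilbert curve -/

/-- Two parameters at distance at most `2⁻ᵈᵐ` lie in equal or neighbouring intervals of
level `m`, so their images lie in equal or adjacent cubes. -/
theorem abs_hilbertCurve_sub_le_of_level (hh : IsHilbertSequence d h) {m : ℕ} {x y : ℝ}
    (hxy : |x - y| * 2 ^ (d * m) ≤ 1) (j : Fin d) :
    |hilbertCurve d h x j - hilbertCurve d h y j| ≤ 2 * (1 / 2) ^ m := by
  wlog hle : x ≤ y generalizing x y
  · rw [abs_sub_comm]
    exact this (by rwa [abs_sub_comm]) (le_of_not_ge hle)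
  have hp : (0 : ℝ) < 2 ^ (d * m) := by positivity
  have hfl1 : ⌊x * 2 ^ (d * m)⌋₊ ≤ ⌊y * 2 ^ (d * m)⌋₊ := Nat.floor_mono (by gcongr)
  have hfl2 : ⌊y * 2 ^ (d * m)⌋₊ ≤ ⌊x * 2 ^ (d * m)⌋₊ + 1 := by
    rw [abs_sub_comm, abs_of_nonneg (by linarith)] at hxy
    have h1 := Nat.lt_floor_add_one (x * 2 ^ (d * m))
    refine Nat.lt_succ_iff.1 ((Nat.floor_lt' (by omega)).2 ?_)
    push_cast
    linarith
  have hcases : hilbertIntervalIndex d m y = hilbertIntervalIndex d m x ∨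
      hilbertIntervalIndex d m y = hilbertIntervalIndex d m x + 1 := by
    unfold hilbertIntervalIndex
    omega
  obtain ⟨h1, h2⟩ := hh.hilbertCurve_mem m x j
  obtain ⟨h3, h4⟩ := hh.hilbertCurve_mem m y j
  have hy := hilbertIntervalIndex_lt d m y
  have hp2 : (0 : ℝ) < (1 / 2) ^ m := by positivity
  have key : |(h m (hilbertIntervalIndex d m x) j : ℝ) - h m (hilbertIntervalIndex d m y) j|
      ≤ 1 := by
    rcases hcases with hc | hc
    · simp [hc]
    · rw [hc] at hy ⊢
      obtain ⟨i, hi, hne⟩ := hh.adjacency m _ hy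
      by_cases hij : j = i
      · subst hij
        rcases hi with hi | hi <;> rw [hi] <;> simp
      · simp [hne j hij]
  rw [abs_le] at key
  rw [abs_le]
  have hdiv : ∀ t : ℝ, t / 2 ^ m = t * (1 / 2) ^ m := fun t => by
    rw [one_div_pow]
    ring
  rw [hdiv] at h1 h2 h3 h4
  constructor <;> nlinarith

/-- Hölder continuity of exponent `1 / d`, in the supremum norm. -/
theorem abs_hilbertCurve_sub_le (hh : IsHilbertSequence d h) (hd : 0 < d) {N : ℕ} (hN : 0 < N)
    {x y : ℝ} (hxy : |x - y| ≤ 1 / N) (j : Fin d) :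
    |hilbertCurve d h x j - hilbertCurve d h y j| ≤ 4 * (N : ℝ) ^ (-1 / (d : ℝ)) := by
  -- `m` is the finest level at which the intervals are still at least as long as `1 / N`
  set m := Nat.log (2 ^ d) N with hm
  have hle : (2 ^ d) ^ m ≤ N := Nat.pow_log_le_self _ hN.ne'
  have hlt : N < (2 ^ d) ^ (m + 1) :=
    Nat.lt_pow_succ_log_self (Nat.one_lt_two_pow hd.ne') _
  have hN' : (0 : ℝ) < N := by exact_mod_cast hN
  have hd' : (d : ℝ) ≠ 0 := by exact_mod_cast hd.ne'
  have h1 : |x - y| * 2 ^ (d * m) ≤ 1 := by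
    have : (2 : ℝ) ^ (d * m) ≤ N := by
      rw [pow_mul]
      exact_mod_cast hle
    calc |x - y| * 2 ^ (d * m) ≤ 1 / N * N := by gcongr
      _ = 1 := by field_simp
  refine (hh.abs_hilbertCurve_sub_le_of_level h1 j).trans ?_
  have h2 : (1 / 2 : ℝ) ^ (m + 1) ≤ (N : ℝ) ^ (-1 / (d : ℝ)) := by
    have h3 : (N : ℝ) ≤ ((2 : ℝ) ^ (m + 1)) ^ d := by
      rw [← pow_mul, mul_comm, pow_mul]
      exact_mod_cast hlt.le
    have h4 : (N : ℝ) ^ (1 / (d : ℝ)) ≤ 2 ^ (m + 1) := by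
      calc (N : ℝ) ^ (1 / (d : ℝ)) ≤ (((2 : ℝ) ^ (m + 1)) ^ d) ^ (1 / (d : ℝ)) := by gcongr
        _ = 2 ^ (m + 1) := by
          rw [one_div]
          exact Real.pow_rpow_inv_natCast (by positivity) hd.ne'
    rw [neg_div, Real.rpow_neg hN'.le, one_div_pow, one_div]
    exact inv_anti₀ (by positivity) h4
  calc 2 * (1 / 2 : ℝ) ^ m = 4 * (1 / 2) ^ (m + 1) := by ring
    _ ≤ _ := by gcongr

end IsHilbertSequence

/-! ### Van der Corput points -/

/-- The integer whose base-`b` expansion consists of the `j` lowest base-`b` digits of `i` in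
reversed order. -/
def digitReversal (b : ℕ) : ℕ → ℕ → ℕ
  | 0, _ => 0
  | j + 1, i => i % b * b ^ j + digitReversal b j (i / b)

theorem digitReversal_lt {b : ℕ} (hb : 0 < b) (j i : ℕ) : digitReversal b j i < b ^ j := by
  induction j generalizing i with
  | zero => simp [digitReversal]
  | succ j ih =>
    have h1 := ih (i / b)
    have h2 : (i % b + 1) * b ^ j ≤ b * b ^ j := Nat.mul_le_mul_right _ (Nat.mod_lt i hb)
    rw [digitReversal, pow_succ']
    linarith

theorem modEq_of_digitReversal_eq {b : ℕ} (hb : 0 < b) {j i i' : ℕ}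
    (h : digitReversal b j i = digitReversal b j i') : i ≡ i' [MOD b ^ j] := by
  induction j generalizing i i' with
  | zero => simp [Nat.modEq_one]
  | succ j ih =>
    have h1 := digitReversal_lt hb j (i / b)
    have h2 := digitReversal_lt hb j (i' / b)
    have hp : 0 < b ^ j := by positivity
    simp only [digitReversal] at h
    have hdiv : i % b = i' % b := by
      have := congrArg (· / b ^ j) h
      simpa [mul_comm _ (b ^ j), Nat.mul_add_div hp, Nat.div_eq_of_lt h1,
        Nat.div_eq_of_lt h2] using this
    have hmod := ih (i := i / b) (i' := i' / b) (by rw [hdiv] at h; omega)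
    rw [Nat.ModEq, pow_succ', Nat.mod_mul, Nat.mod_mul, hdiv, hmod]

theorem vanDerCorput_eq_add {b : ℕ} (hb : 2 ≤ b) (i : ℕ) :
    vanDerCorput b i = ((i % b : ℕ) + vanDerCorput b (i / b)) / b := by
  have hsum : Summable fun k : ℕ => ((i / b ^ k % b : ℕ) : ℝ) / (b : ℝ) ^ (k + 1) := by
    refine summable_of_ne_finset_zero (s := Finset.range i) fun k hk => ?_
    have hk : i < b ^ k := (not_lt.1 (Finset.mem_range.not.1 hk)).trans_lt (Nat.lt_pow_self hb)
    simp [Nat.div_eq_of_lt hk]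
  unfold vanDerCorput
  rw [hsum.tsum_eq_zero_add, add_div, ← tsum_div_const]
  congr 1
  · simp
  · refine tsum_congr fun k => ?_
    rw [Nat.div_div_eq_div_mul, ← pow_succ', div_div, ← pow_succ]

theorem vanDerCorput_mem_Ico {b : ℕ} (hb : 2 ≤ b) (i : ℕ) :
    vanDerCorput b i ∈ Set.Ico (0 : ℝ) 1 := by
  induction i using Nat.strong_induction_on with
  | _ i ih =>
    rcases Nat.eq_zero_or_pos i with rfl | hi
    · simp [vanDerCorput]
    · obtain ⟨h0, h1⟩ := ih (i / b) (Nat.div_lt_self hi hb)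
      have hb' : (0 : ℝ) < b := by positivity
      have hm : ((i % b : ℕ) : ℝ) + 1 ≤ b := by exact_mod_cast Nat.mod_lt i (by omega : b > 0)
      rw [vanDerCorput_eq_add hb]
      exact ⟨by positivity, (div_lt_one hb').2 (by linarith)⟩

/-- The half-open interval `[c / N, (c + 1) / N)`. -/
def gridInterval (N c : ℕ) : Set ℝ := Set.Ico ((c : ℝ) / N) (((c : ℝ) + 1) / N)

theorem vanDerCorput_mem_gridInterval {b : ℕ} (hb : 2 ≤ b) (j i : ℕ) :
    vanDerCorput b i ∈ gridInterval (b ^ j) (digitReversal b j i) := by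
  induction j generalizing i with
  | zero => simpa [gridInterval, digitReversal] using vanDerCorput_mem_Ico hb i
  | succ j ih =>
    have hb' : (0 : ℝ) < b := by positivity
    have hp : (0 : ℝ) < (b : ℝ) ^ j := by positivity
    obtain ⟨h1, h2⟩ := ih (i / b)
    push_cast at h1 h2
    rw [div_le_iff₀ hp] at h1
    rw [lt_div_iff₀ hp] at h2
    have he : vanDerCorput b i * (b : ℝ) ^ (j + 1) =
        (i % b : ℕ) * (b : ℝ) ^ j + vanDerCorput b (i / b) * (b : ℝ) ^ j := by
      rw [vanDerCorput_eq_add hb, pow_succ]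
      field_simp
    unfold gridInterval
    push_cast [digitReversal]
    rw [Set.mem_Ico, div_le_iff₀ (by positivity), lt_div_iff₀ (by positivity), he]
    constructor <;> linarith

theorem injOn_digitReversal {b : ℕ} (hb : 0 < b) (j s : ℕ) :
    Set.InjOn (fun i => digitReversal b j (s + i)) (Finset.range (b ^ j)) := by
  intro i hi i' hi' h
  have h1 : i ≡ i' [MOD b ^ j] := (modEq_of_digitReversal_eq hb h).add_left_cancel'
  exact h1.eq_of_lt_of_lt (by simpa using hi) (by simpa using hi')

/-- Among any `bʲ` consecutive van der Corput points, each interval `[c / bʲ, (c + 1) / bʲ)`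
contains exactly one. -/
theorem sum_digitReversal {b : ℕ} (hb : 0 < b) (j s : ℕ) (f : ℕ → ℝ) :
    ∑ i ∈ Finset.range (b ^ j), f (digitReversal b j (s + i)) =
      ∑ c ∈ Finset.range (b ^ j), f c := by
  have hinj := injOn_digitReversal hb j s
  rw [← Finset.sum_image (g := fun i => digitReversal b j (s + i)) (f := f) hinj]
  refine Finset.sum_congr (Finset.eq_of_subset_of_card_le ?_ ?_) fun _ _ => rfl
  · intro c hc
    obtain ⟨i, -, rfl⟩ := Finset.mem_image.1 hc
    exact Finset.mem_range.2 (digitReversal_lt hb j _)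
  · rw [Finset.card_image_of_injOn hinj]

/-! ### Counting points in a set of parameters -/

theorem measurableSet_gridInterval (N c : ℕ) : MeasurableSet (gridInterval N c) :=
  measurableSet_Ico

theorem volume_real_gridInterval (N c : ℕ) : volume.real (gridInterval N c) = 1 / N := by
  rw [gridInterval, Real.volume_real_Ico_of_le (by gcongr; linarith)]
  ring

theorem pairwiseDisjoint_gridInterval {N : ℕ} (hN : 0 < N) :
    Pairwise (Function.onFun Disjoint (gridInterval N)) := by
  intro c c' hne
  refine Set.disjoint_left.2 fun x hx hx' => hne ?_
  have hN' : (0 : ℝ) < N := by exact_mod_cast hN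
  have h1 := (div_lt_div_iff_of_pos_right hN').1 (hx.1.trans_lt hx'.2)
  have h2 := (div_lt_div_iff_of_pos_right hN').1 (hx'.1.trans_lt hx.2)
  norm_cast at h1 h2
  omega

theorem iUnion_gridInterval {N : ℕ} (hN : 0 < N) :
    ⋃ c ∈ Finset.range N, gridInterval N c = Set.Ico 0 1 := by
  have hN' : (0 : ℝ) < N := by exact_mod_cast hN
  ext x
  simp only [Set.mem_iUnion, Finset.mem_range, exists_prop]
  constructor
  · rintro ⟨c, hc, h1, h2⟩
    have hc' : (c : ℝ) + 1 ≤ N := by exact_mod_cast hc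
    exact ⟨le_trans (by positivity) h1, h2.trans_le ((div_le_one hN').2 hc')⟩
  · rintro ⟨h0, h1⟩
    refine ⟨⌊x * N⌋₊, (Nat.floor_lt (by positivity)).2 (by nlinarith), ?_, ?_⟩
    · exact (div_le_iff₀ hN').2 (Nat.floor_le (by positivity))
    · exact (lt_div_iff₀ hN').2 (Nat.lt_floor_add_one _)

/-- The numbers `c < N` of the intervals `[c / N, (c + 1) / N)` that meet both `A` and its
complement. -/
noncomputable def crossingIndices (A : Set ℝ) (N : ℕ) : Finset ℕ :=
  open Classical in
  (Finset.range N).filter fun c => ∃ x ∈ gridInterval N c, ∃ y ∈ gridInterval N c, x ∈ A ∧ y ∉ A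

theorem sum_volume_real_inter_gridInterval {A : Set ℝ} (hA : MeasurableSet A) {N : ℕ}
    (hN : 0 < N) :
    ∑ c ∈ Finset.range N, volume.real (A ∩ gridInterval N c) =
      volume.real (A ∩ Set.Ico 0 1) := by
  have hfin : ∀ c ∈ Finset.range N, volume (A ∩ gridInterval N c) ≠ ⊤ := fun c _ =>
    measure_ne_top_of_subset Set.inter_subset_right measure_Ico_lt_top.ne
  rw [← iUnion_gridInterval hN, Set.inter_iUnion₂, measureReal_biUnion_finset (h := hfin)]
  · exact fun c _ c' _ hne =>
      ((pairwiseDisjoint_gridInterval hN) hne).mono Set.inter_subset_right Set.inter_subset_right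
  · exact fun c _ => hA.inter (measurableSet_gridInterval N c)

/-- The counting error of a block of `bʲ` consecutive van der Corput points comes only from the
`b`-adic intervals of level `j` that are cut by the set. -/
theorem abs_sum_indicator_sub_le_card_crossingIndices {b : ℕ} (hb : 2 ≤ b) {A : Set ℝ}
    (hA : MeasurableSet A) (j s : ℕ) :
    |∑ i ∈ Finset.range (b ^ j), A.indicator (1 : ℝ → ℝ) (vanDerCorput b (s + i)) -
        (b ^ j : ℕ) * volume.real (A ∩ Set.Ico 0 1)| ≤ (crossingIndices A (b ^ j)).card := by
  classical
  have hb0 : 0 < b := by omega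
  set N := b ^ j with hN
  have hN0 : 0 < N := by positivity
  have hN' : (0 : ℝ) < N := by exact_mod_cast hN0
  rw [← sum_volume_real_inter_gridInterval hA hN0, Finset.mul_sum,
    ← sum_digitReversal hb0 j s fun c => (N : ℝ) * volume.real (A ∩ gridInterval N c),
    ← Finset.sum_sub_distrib]
  have hcard : ((crossingIndices A N).card : ℝ) =
      ∑ c ∈ Finset.range N, if c ∈ crossingIndices A N then (1 : ℝ) else 0 := by
    have hsub : crossingIndices A N ⊆ Finset.range N := Finset.filter_subset _ _
    rw [Finset.sum_ite_mem, Finset.inter_eq_right.2 hsub]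
    simp
  rw [hcard, ← sum_digitReversal hb0 j s fun c =>
    if c ∈ crossingIndices A N then (1 : ℝ) else 0]
  refine (Finset.abs_sum_le_sum_abs _ _).trans (Finset.sum_le_sum fun i _ => ?_)
  have hx := vanDerCorput_mem_gridInterval hb j (s + i)
  have hc := digitReversal_lt hb0 j (s + i)
  rw [← hN] at hx hc
  set c := digitReversal b j (s + i)
  set x := vanDerCorput b (s + i)
  have hvol : (N : ℝ) * volume.real (gridInterval N c) = 1 := by
    rw [volume_real_gridInterval]
    field_simp
  have hle : (N : ℝ) * volume.real (A ∩ gridInterval N c) ≤ 1 := by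
    rw [← hvol]
    gcongr
    · exact measure_Ico_lt_top.ne
    · exact Set.inter_subset_right
  have hge : 0 ≤ (N : ℝ) * volume.real (A ∩ gridInterval N c) := by positivity
  have hcross : c ∉ crossingIndices A N →
      ∀ y ∈ gridInterval N c, ∀ z ∈ gridInterval N c, y ∈ A → z ∈ A := by
    intro hnot y hy z hz hyA
    by_contra hzA
    exact hnot (Finset.mem_filter.2 ⟨Finset.mem_range.2 hc, y, hy, z, hz, hyA, hzA⟩)
  by_cases hxA : x ∈ A
  · rw [Set.indicator_of_mem hxA, Pi.one_apply]
    split_ifs with hmem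
    · rw [abs_le]
      constructor <;> linarith
    · have : A ∩ gridInterval N c = gridInterval N c :=
        Set.inter_eq_right.2 fun z hz => hcross hmem x hx z hz hxA
      rw [this, hvol]
      simp
  · rw [Set.indicator_of_notMem hxA]
    split_ifs with hmem
    · rw [abs_le]
      constructor <;> linarith
    · have : A ∩ gridInterval N c = ∅ := by
        refine Set.eq_empty_of_forall_notMem fun z hz => hxA ?_
        exact hcross hmem z hz.2 x hx hz.1
      simp [this]

/-- Passage from blocks of `bʲ` points to `n` points, by the base-`b` expansion of `n`. -/
theorem abs_sum_sub_le_of_blocks {b : ℕ} (hb : 2 ≤ b) (f : ℕ → ℝ) (v : ℝ) (g : ℕ → ℝ)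
    (hblock : ∀ j s, |∑ i ∈ Finset.range (b ^ j), f (s + i) - (b ^ j : ℕ) * v| ≤ g j)
    (J n s : ℕ) (hn : n < b ^ J) :
    |∑ i ∈ Finset.range n, f (s + i) - n * v| ≤ (b - 1) * ∑ j ∈ Finset.range J, g j := by
  have hruns : ∀ j q s, |∑ i ∈ Finset.range (q * b ^ j), f (s + i) - (q * b ^ j : ℕ) * v| ≤
      q * g j := by
    intro j q
    induction q with
    | zero => simp
    | succ q ih =>
      intro s
      have h1 := ih s
      have h2 := hblock j (s + q * b ^ j)
      rw [add_mul, one_mul, Finset.sum_range_add]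
      simp only [← add_assoc]
      rw [abs_le] at *
      push_cast at *
      constructor <;> linarith
  induction J generalizing n s with
  | zero =>
    have : n = 0 := by simpa using hn
    simp [this]
  | succ J ih =>
    have hp : 0 < b ^ J := by positivity
    have hq : n / b ^ J ≤ b - 1 :=
      Nat.le_sub_one_of_lt (Nat.div_lt_of_lt_mul (by rwa [pow_succ] at hn))
    have hq' : ((n / b ^ J : ℕ) : ℝ) ≤ b - 1 := by
      rw [← Nat.cast_pred (by omega)]
      exact_mod_cast hq
    have h1 := hruns J (n / b ^ J) s
    have h2 := ih (n % b ^ J) (s + n / b ^ J * b ^ J) (Nat.mod_lt _ hp)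
    have hg : 0 ≤ g J := (abs_nonneg _).trans (hblock J 0)
    have h3 : ((n / b ^ J : ℕ) : ℝ) * g J ≤ (b - 1) * g J := by gcongr
    have hn' : n / b ^ J * b ^ J + n % b ^ J = n := Nat.div_add_mod' n (b ^ J)
    have hcast : (n : ℝ) = ((n / b ^ J * b ^ J : ℕ) : ℝ) + ((n % b ^ J : ℕ) : ℝ) := by
      exact_mod_cast hn'.symm
    have hsum : ∑ i ∈ Finset.range n, f (s + i) =
        ∑ i ∈ Finset.range (n / b ^ J * b ^ J), f (s + i) +
          ∑ i ∈ Finset.range (n % b ^ J), f (s + n / b ^ J * b ^ J + i) := by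
      conv_lhs => rw [← hn', Finset.sum_range_add]
      simp only [add_assoc]
    rw [hsum, hcast, Finset.sum_range_succ, mul_add]
    rw [abs_le] at *
    constructor <;> linarith

/-! ### The parameters of an anchored box -/

theorem measurableSet_anchoredBox {d : ℕ} (a : Fin d → ℝ) : MeasurableSet (anchoredBox a) := by
  have : anchoredBox a = Set.univ.pi fun j => Set.Ico 0 (a j) := by
    ext p
    simp [anchoredBox, Set.mem_pi]
  rw [this]
  exact MeasurableSet.univ_pi fun j => measurableSet_Ico

theorem volume_real_slab_le {d : ℕ} (j : Fin d) (t : ℝ) {ε : ℝ} (hε : 0 ≤ ε) :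
    volume.real ({p : Fin d → ℝ | |p j - t| ≤ ε} ∩ Set.Icc 0 1) ≤ 2 * ε := by
  classical
  have hsub : {p : Fin d → ℝ | |p j - t| ≤ ε} ∩ Set.Icc 0 1 ⊆
      Set.Icc (Function.update 0 j (t - ε)) (Function.update 1 j (t + ε)) := by
    rintro p ⟨hp, h0, h1⟩
    rw [Set.mem_ofPred_eq, abs_le] at hp
    refine ⟨update_le_iff.2 ⟨by linarith, fun i _ => h0 i⟩,
      le_update_iff.2 ⟨by linarith, fun i _ => h1 i⟩⟩
  refine (measureReal_mono hsub isCompact_Icc.measure_lt_top.ne).trans ?_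
  rw [measureReal_def, Real.volume_Icc_pi_toReal]
  · rw [Finset.prod_eq_single j]
    · simp
      linarith
    · intro i _ hi
      simp [hi]
    · simp
  · rw [update_le_update_iff]
    exact ⟨by linarith, fun i _ => zero_le_one⟩

namespace IsHilbertSequence

variable {d : ℕ} {h : ℕ → ℕ → Fin d → ℕ}

/-- An interval `[c / N, (c + 1) / N)` whose image is cut by the boundary of the box `[0, a)` is
mapped close to one of the `d` hyperplanes `p j = a j`. The images of these intervals fill a part
of the corresponding slab, and this bounds their number. -/
theorem card_crossingIndices_le (hh : IsHilbertSequence d h) (hd : 0 < d) {N : ℕ} (hN : 0 < N)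
    (a : Fin d → ℝ) :
    ((crossingIndices (hilbertCurve d h ⁻¹' anchoredBox a) N).card : ℝ) ≤
      8 * d * (N * (N : ℝ) ^ (-1 / (d : ℝ))) := by
  classical
  have hN' : (0 : ℝ) < N := by exact_mod_cast hN
  set ε := 4 * (N : ℝ) ^ (-1 / (d : ℝ)) with hε
  have hε0 : 0 ≤ ε := by positivity
  let S : Fin d → Set (Fin d → ℝ) := fun j => {p | |p j - a j| ≤ ε}
  let T : Fin d → Finset ℕ := fun j =>
    (Finset.range N).filter fun c => gridInterval N c ⊆ hilbertCurve d h ⁻¹' S j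
  have hS : ∀ j, MeasurableSet (S j) := fun j =>
    measurableSet_le (by fun_prop) measurable_const
  have hsub : crossingIndices (hilbertCurve d h ⁻¹' anchoredBox a) N ⊆
      Finset.univ.biUnion T := by
    intro c hc
    obtain ⟨hcN, x, hx, y, hy, hxB, hyB⟩ := Finset.mem_filter.1 hc
    -- the cube has no points with a negative coordinate, so `H y` leaves the box through an
    -- upper face
    have hj : ∃ j, a j ≤ hilbertCurve d h y j := by
      by_contra! hlt
      exact hyB fun j => ⟨hh.hilbertCurve_nonneg y j, hlt j⟩
    obtain ⟨j, hj⟩ := hj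
    refine Finset.mem_biUnion.2 ⟨j, Finset.mem_univ j, Finset.mem_filter.2 ⟨hcN, fun z hz => ?_⟩⟩
    have hdist : ∀ w ∈ gridInterval N c, |z - w| ≤ 1 / N := by
      rintro w ⟨hw1, hw2⟩
      obtain ⟨hz1, hz2⟩ := hz
      rw [add_div] at hz2 hw2
      rw [abs_le]
      constructor <;> linarith
    have h1 := abs_le.1 (hh.abs_hilbertCurve_sub_le hd hN (hdist x hx) j)
    have h2 := abs_le.1 (hh.abs_hilbertCurve_sub_le hd hN (hdist y hy) j)
    have h3 := (hxB j).2
    change |hilbertCurve d h z j - a j| ≤ ε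
    rw [abs_le]
    constructor <;> linarith
  have hT : ∀ j, ((T j).card : ℝ) ≤ 8 * (N * (N : ℝ) ^ (-1 / (d : ℝ))) := by
    intro j
    have h1 : ((T j).card : ℝ) * (1 / N) ≤ 2 * ε :=
      calc ((T j).card : ℝ) * (1 / N)
          = ∑ c ∈ T j, volume.real (gridInterval N c) := by
            simp only [volume_real_gridInterval, Finset.sum_const, nsmul_eq_mul]
        _ = volume.real (⋃ c ∈ T j, gridInterval N c) :=
            (measureReal_biUnion_finset
              (fun c _ c' _ hne => pairwiseDisjoint_gridInterval hN hne)
              (fun c _ => measurableSet_gridInterval N c)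
              fun c _ => measure_Ico_lt_top.ne).symm
        _ ≤ volume.real (hilbertCurve d h ⁻¹' S j ∩ Set.Ico 0 1) := by
            refine measureReal_mono (Set.iUnion₂_subset fun c hc => ?_)
              ((measure_mono Set.inter_subset_right).trans_lt measure_Ico_lt_top).ne
            obtain ⟨hcN, hcS⟩ := Finset.mem_filter.1 hc
            refine Set.subset_inter hcS ?_
            rw [← iUnion_gridInterval hN]
            exact Set.subset_biUnion_of_mem (u := gridInterval N) hcN
        _ = volume.real (S j ∩ Set.Icc 0 1) := hh.volume_real_preimage (hS j)
        _ ≤ 2 * ε := volume_real_slab_le j (a j) hε0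
    rw [mul_one_div, div_le_iff₀ hN'] at h1
    linarith
  calc ((crossingIndices (hilbertCurve d h ⁻¹' anchoredBox a) N).card : ℝ)
      ≤ ∑ j, ((T j).card : ℝ) := by
        exact_mod_cast (Finset.card_le_card hsub).trans Finset.card_biUnion_le
    _ ≤ ∑ j : Fin d, 8 * (N * (N : ℝ) ^ (-1 / (d : ℝ))) := Finset.sum_le_sum fun j _ => hT j
    _ = 8 * d * (N * (N : ℝ) ^ (-1 / (d : ℝ))) := by
        simp only [Finset.sum_const, Finset.card_univ, Fintype.card_fin, nsmul_eq_mul]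
        ring

/-- The block errors `8 d b^(j (d - 1) / d)` form a geometric sequence; its sum over the levels
`j ≤ log_b n` is dominated by the top level. -/
theorem abs_signedDiscrepancy_le (hh : IsHilbertSequence d h) (hd : 1 < d) {b : ℕ} (hb : 2 ≤ b)
    {n : ℕ} (hn : 1 ≤ n) (s : ℕ) {a : Fin d → ℝ} (ha : ∀ j, a j < 1) :
    |signedDiscrepancy (fun i : Fin n => hilbertCurve d h (vanDerCorput b (i.val + s)))
        (anchoredBox a)| ≤
      8 * d * (b - 1) / (1 - (b : ℝ) ^ (-((d : ℝ) - 1) / d)) * (n : ℝ) ^ (-1 / (d : ℝ)) := by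
  classical
  set A := hilbertCurve d h ⁻¹' anchoredBox a with hA
  have hAm : MeasurableSet A := hh.measurable_hilbertCurve (measurableSet_anchoredBox a)
  have hn' : (0 : ℝ) < n := by exact_mod_cast hn
  have hd' : (1 : ℝ) < d := by exact_mod_cast hd
  have hb' : (2 : ℝ) ≤ b := by exact_mod_cast hb
  have hb0 : (0 : ℝ) < b := by linarith
  have hd0 : (0 : ℝ) < d := by linarith
  have hvol : volume.real (A ∩ Set.Ico 0 1) = volume.real (anchoredBox a) := by
    have hsub : anchoredBox a ⊆ Set.Icc 0 1 := fun p hp =>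
      ⟨fun j => (hp j).1, fun j => ((hp j).2.trans (ha j)).le⟩
    rw [hh.volume_real_preimage (measurableSet_anchoredBox a), Set.inter_eq_left.2 hsub]
  have hcount : ((Finset.univ.filter fun i : Fin n =>
      hilbertCurve d h (vanDerCorput b (i.val + s)) ∈ anchoredBox a).card : ℝ) =
      ∑ i ∈ Finset.range n, A.indicator (1 : ℝ → ℝ) (vanDerCorput b (s + i)) := by
    rw [Finset.sum_range fun i => A.indicator (1 : ℝ → ℝ) (vanDerCorput b (s + i)),
      Finset.natCast_card_filter]
    refine Finset.sum_congr rfl fun i _ => ?_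
    rw [Set.indicator_apply, add_comm s]
    rfl
  set α : ℝ := ((d : ℝ) - 1) / d with hα
  have hα0 : 0 < α := div_pos (by linarith) hd0
  have hpow : ∀ t : ℝ, 0 < t → t * t ^ (-1 / (d : ℝ)) = t ^ α := fun t ht => by
    rw [← Real.rpow_one_add' ht.le]
    · congr 1
      rw [hα]
      field_simp
      ring
    · have : 1 + -1 / (d : ℝ) = α := by
        rw [hα]
        field_simp
        ring
      rw [this]
      exact hα0.ne'
  set r : ℝ := (b : ℝ) ^ α with hr
  have hr1 : 1 < r := Real.one_lt_rpow (by linarith) hα0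
  have hrinv : (b : ℝ) ^ (-((d : ℝ) - 1) / d) = r⁻¹ := by
    rw [neg_div, Real.rpow_neg hb0.le]
  have hblock : ∀ j s, |∑ i ∈ Finset.range (b ^ j),
      A.indicator (1 : ℝ → ℝ) (vanDerCorput b (s + i)) -
        (b ^ j : ℕ) * volume.real (A ∩ Set.Ico 0 1)| ≤ 8 * d * r ^ j := by
    intro j s
    refine (abs_sum_indicator_sub_le_card_crossingIndices hb hAm j s).trans ?_
    refine (hh.card_crossingIndices_le (by omega) (by positivity) a).trans_eq ?_
    rw [hpow _ (by positivity)]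
    push_cast
    rw [hr, ← Real.rpow_natCast, ← Real.rpow_natCast, ← Real.rpow_mul hb0.le,
      ← Real.rpow_mul hb0.le, mul_comm α]
  have hmain := abs_sum_sub_le_of_blocks hb
    (fun i => A.indicator (1 : ℝ → ℝ) (vanDerCorput b i)) _ (fun j => 8 * d * r ^ j) hblock
    (Nat.log b n + 1) n s (Nat.lt_pow_succ_log_self hb n)
  rw [← Finset.mul_sum] at hmain
  have hrn : r ^ Nat.log b n ≤ (n : ℝ) ^ α := by
    have h1 : (b : ℝ) ^ Nat.log b n ≤ n := by
      exact_mod_cast Nat.pow_log_le_self b (by omega : n ≠ 0)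
    calc r ^ Nat.log b n = ((b : ℝ) ^ Nat.log b n) ^ α := by
          rw [hr, ← Real.rpow_natCast, ← Real.rpow_natCast, ← Real.rpow_mul hb0.le,
            ← Real.rpow_mul hb0.le, mul_comm α]
      _ ≤ (n : ℝ) ^ α := by gcongr
  have hrinv1 : 0 < 1 - r⁻¹ := sub_pos.2 (inv_lt_one_of_one_lt₀ hr1)
  have hgeom : ∑ j ∈ Finset.range (Nat.log b n + 1), r ^ j ≤ (n : ℝ) ^ α / (1 - r⁻¹) := by
    rw [le_div_iff₀ hrinv1]
    have h1 := geom_sum_mul r (Nat.log b n + 1)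
    calc (∑ j ∈ Finset.range (Nat.log b n + 1), r ^ j) * (1 - r⁻¹)
        = ((∑ j ∈ Finset.range (Nat.log b n + 1), r ^ j) * (r - 1)) / r := by
          field_simp
      _ = r ^ Nat.log b n - 1 / r := by
          rw [h1]
          field_simp
          ring
      _ ≤ (n : ℝ) ^ α := by
          have : 0 < 1 / r := by positivity
          linarith
  have hsd : signedDiscrepancy (fun i : Fin n => hilbertCurve d h (vanDerCorput b (i.val + s)))
      (anchoredBox a) = (∑ i ∈ Finset.range n, A.indicator (1 : ℝ → ℝ) (vanDerCorput b (s + i)) -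
        n * volume.real (A ∩ Set.Ico 0 1)) / n := by
    rw [signedDiscrepancy, ← hvol, ← hcount]
    field_simp
  rw [hsd, abs_div, abs_of_pos hn', div_le_iff₀ hn', hrinv]
  refine hmain.trans ?_
  have hb1 : (0 : ℝ) ≤ b - 1 := by linarith
  calc ((b : ℝ) - 1) * (8 * d * ∑ j ∈ Finset.range (Nat.log b n + 1), r ^ j)
      ≤ (b - 1) * (8 * d * ((n : ℝ) ^ α / (1 - r⁻¹))) := by gcongr
    _ = 8 * d * (b - 1) / (1 - r⁻¹) * (n : ℝ) ^ (-1 / (d : ℝ)) * n := by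
        rw [← hpow n hn']
        ring

end IsHilbertSequence

theorem mainTheorem2 (d b : ℕ) (hd : 1 < d) (hb : 2 ≤ b) :
    ∃ C : ℝ, ∀ h : ℕ → ℕ → Fin d → ℕ, IsHilbertSequence d h →
      ∀ n : ℕ, 1 ≤ n → ∀ s : ℕ, s = 0 ∨ s = 1 →
        starDiscrepancy (fun i : Fin n => hilbertCurve d h (vanDerCorput b (i.val + s))) ≤
          4 * d * (b - 1) * √((d : ℝ) + 3) / (1 - (b : ℝ) ^ (-((d : ℝ) - 1) / d))
              * (n : ℝ) ^ (-1 / (d : ℝ))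
            + C * ((n : ℝ) ^ (-2 / (d : ℝ)) * Real.log n) := by
  -- the leading term alone is a bound, so the error term can be given the coefficient `0`
  refine ⟨0, fun h hh n hn s _ => ?_⟩
  have hd' : (1 : ℝ) < d := by exact_mod_cast hd
  have hb' : (2 : ℝ) ≤ b := by exact_mod_cast hb
  have hb1 : (0 : ℝ) ≤ b - 1 := by linarith
  have hsqrt : 2 ≤ √((d : ℝ) + 3) := Real.le_sqrt_of_sq_le (by linarith)
  have hden : 0 ≤ 1 - (b : ℝ) ^ (-((d : ℝ) - 1) / d) := by
    refine sub_nonneg.2 (Real.rpow_le_one_of_one_le_of_nonpos (by linarith) ?_)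
    exact div_nonpos_of_nonpos_of_nonneg (by linarith) (by linarith)
  rw [zero_mul, add_zero]
  have : Nonempty {a : Fin d → ℝ // ∀ j, 0 ≤ a j ∧ a j < 1} := ⟨0, by simp⟩
  refine ciSup_le fun a =>
    (hh.abs_signedDiscrepancy_le hd hb hn s fun j => (a.2 j).2).trans ?_
  have hnum : 8 * (d : ℝ) * (b - 1) ≤ 4 * d * (b - 1) * √((d : ℝ) + 3) := by
    have : (0 : ℝ) ≤ 4 * d * (b - 1) := by positivity
    nlinarith
  gcongr
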